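/- Let $p$ be a prime, $k$ an algebraically closed field of characteristic $p$, $G$ a finite group and $P\le G$ a $p$-subgroup. Let $M=S(G,P)$ be the Scott module, i.e. the (up to isomorphism unique) indecomposable direct summand of $\mathrm{Ind}_P^G(k)$ whose socle contains the trivial $kG$-module, and let $\ker(M)=\{g\in G\mid gm=m\text{ for all }m\in M\}$. Let $\mathcal F_P(G)$ be the category whose objects are the subgroups of $P$ and whose morphisms $Q\to Q'$ are the group homomorphisms induced by conjugation by elements of $G$, and assume that $\mathcal F_P(G)$ is a saturated fusion system. For a $p$-subgroup $Q\le G$ and $S\le Q$ put $M^Q=\{m\in M\mid ym=m\text{ for all }y\in Q\}$ and $M^Q_S=\{\sum_{x\in[Q/S]}xm\mid m\in M^S\}$, and let $M(Q)=M^Q/\sum_{S<Q}M^Q_S$, a $kN_G(Q)$-module. The module $M$ is called Brauer indecomposable if, for every $p$-subgroup $Q\le G$, the module $\mathrm{Res}^{N_G(Q)}_{QC_G(Q)}M(Q)$ is indecomposable or zero. Let $R\trianglelefteq G$ be a normal subgroup with $R\le P\cap\ker(M)$. If $\mathrm{Res}^G_{C_G(T)}M$ is indecomposable for every maximal subgroup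 $T$ of $P$ with $R\le T$, then $M$ is Brauer indecomposable. Moreover, with $\mathrm{core}_G(P)=\bigcap_{x\in G}xPx^{-1}$, one has $\mathrm{core}_G(P)\le P\cap\ker(M)$, and every normal subgroup $R$ of $G$ with $R\le P\cap\ker(M)$ is contained in $\mathrm{core}_G(P)$. -/

import Mathlib

namespace BrauerScott

/-! ### Indecomposable modules, direct summands -/

section Modules

variable {k G V W : Type*} [Field k] [Group G] [AddCommGroup V] [Module k V]
  [AddCommGroup W] [Module k W]

/-- A `kG`-module is indecomposable if it is nonzero and it is not the direct sum of two nonzero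
submodules. -/
def IsIndecomposable (ρ : Representation k G V) : Prop :=
  Nontrivial V ∧ ∀ U W : Subrepresentation ρ, IsCompl U W → U = ⊥ ∨ W = ⊥

/-- `ρ ∣ σ`: the module `ρ` is isomorphic to a direct summand of `σ`, that is, there are
`kG`-homomorphisms `i : ρ → σ` and `r : σ → ρ` with `r ∘ i = id`. -/
def IsDirectSummand (ρ : Representation k G V) (σ : Representation k G W) : Prop :=
  ∃ (i : Representation.IntertwiningMap ρ σ) (r : Representation.IntertwiningMap σ ρ),
    ∀ v : V, r (i v) = v

/-- The restriction of a `kG`-module to a subgroup `H` of `G`. -/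
abbrev resSubgroup (ρ : Representation k G V) (H : Subgroup G) : Representation k H V :=
  ρ.comp H.subtype

/-- `ρ` is a Scott module `S(G, P)` (for a `p`-subgroup `P`): an indecomposable direct summand of
the module induced from the trivial `kP`-module `k`, whose socle contains the trivial `kG`-module
(that is, which has a nonzero vector fixed by `G`). -/
def IsScottModule (P : Subgroup G) (ρ : Representation k G V) : Prop :=
  IsIndecomposable ρ ∧
  IsDirectSummand ρ (Representation.ind P.subtype (Representation.trivial k P k)) ∧
  ∃ v : V, v ≠ 0 ∧ ∀ g : G, ρ g v = v

end Modules

/-! ### The Brauer construction -/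

section Brauer

variable {k G V : Type*} [Field k] [Group G] [AddCommGroup V] [Module k V]
  (ρ : Representation k G V)

/-- The fixed points `M ^ Q`. -/
noncomputable def fixedPoints (Q : Subgroup G) : Submodule k V :=
  Representation.invariants (resSubgroup ρ Q)

variable {ρ} in
lemma mem_fixedPoints {Q : Subgroup G} {v : V} :
    v ∈ fixedPoints ρ Q ↔ ∀ q ∈ Q, ρ q v = v := by
  simp [fixedPoints, resSubgroup]

/-- The map `m ↦ ∑ x m`, where `x` runs over representatives of the left cosets of `S` in `Q`.
On `M ^ S` it does not depend on the representatives. -/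
noncomputable def relTrace (S Q : Subgroup G) : V →ₗ[k] V :=
  ∑ᶠ x : Q ⧸ S.subgroupOf Q, ρ ((x.out : Q) : G)

/-- The image `M_S ^ Q` of `M ^ S` under the relative trace map, for `S ≤ Q`. -/
noncomputable def traceImage (S Q : Subgroup G) : Submodule k V :=
  (fixedPoints ρ S).map (relTrace ρ S Q)

/-- The sum of all `M_S ^ Q` for proper subgroups `S < Q`. -/
noncomputable def properTraces (Q : Subgroup G) : Submodule k V :=
  ⨆ (S : Subgroup G) (_ : S < Q), traceImage ρ S Q

lemma sup_centralizer_le_normalizer (Q : Subgroup G) :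
    Q ⊔ Subgroup.centralizer (Q : Set G) ≤ Subgroup.normalizer (Q : Set G) :=
  sup_le Subgroup.le_normalizer (Subgroup.centralizer_le_normalizer _)

lemma apply_out {S Q : Subgroup G} {m : V} (hm : m ∈ fixedPoints ρ S) (q : Q) :
    ρ (((QuotientGroup.mk q : Q ⧸ S.subgroupOf Q).out : Q) : G) m = ρ (q : G) m := by
  obtain ⟨h, hh⟩ := QuotientGroup.mk_out_eq_mul (S.subgroupOf Q) q
  rw [hh, Subgroup.coe_mul, map_mul, Module.End.mul_apply]
  rw [mem_fixedPoints.1 hm _ (Subgroup.mem_subgroupOf.1 h.2)]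

lemma apply_mem_fixedPoints_map (g : G) {S : Subgroup G} {m : V} (hm : m ∈ fixedPoints ρ S) :
    ρ g m ∈ fixedPoints ρ (S.map (MulAut.conj g).toMonoidHom) := by
  rw [mem_fixedPoints]
  rintro _ ⟨s, hs, rfl⟩
  have : (MulAut.conj g).toMonoidHom s * g = g * s := by simp
  rw [← Module.End.mul_apply, ← map_mul, this, map_mul, Module.End.mul_apply,
    mem_fixedPoints.1 hm s hs]

lemma map_conj_of_mem_normalizer {Q : Subgroup G} {g : G}
    (hg : g ∈ Subgroup.normalizer (Q : Set G)) : Q.map (MulAut.conj g).toMonoidHom = Q := by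
  ext x
  rw [Subgroup.mem_map_equiv, MulAut.conj_symm_apply]
  have := Subgroup.mem_normalizer_iff.1 hg (g⁻¹ * x * g)
  rw [this]
  simp [mul_assoc]

variable [Finite G]

lemma relTrace_apply (S Q : Subgroup G) (m : V) :
    relTrace ρ S Q m = ∑ᶠ x : Q ⧸ S.subgroupOf Q, ρ ((x.out : Q) : G) m := by
  classical
  have := Fintype.ofFinite (Q ⧸ S.subgroupOf Q)
  rw [relTrace, finsum_eq_sum_of_fintype, finsum_eq_sum_of_fintype, LinearMap.sum_apply]

lemma apply_relTrace {S Q : Subgroup G} {g : G}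
    (hg : g ∈ Subgroup.normalizer (Q : Set G)) {m : V} (hm : m ∈ fixedPoints ρ S) :
    ρ g (relTrace ρ S Q m) =
      relTrace ρ (S.map (MulAut.conj g).toMonoidHom) Q (ρ g m) := by
  classical
  set S' := S.map (MulAut.conj g).toMonoidHom with hS'
  let c : MulAut Q := Q.normalizerMonoidHom ⟨g, hg⟩
  have hc : ∀ q : Q, ((c q : Q) : G) = g * q * g⁻¹ := fun q => rfl
  let e : Q ⧸ S.subgroupOf Q ≃ Q ⧸ S'.subgroupOf Q := Quotient.congr c.toEquiv (by
    intro a b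
    change QuotientGroup.leftRel _ a b ↔ QuotientGroup.leftRel _ (c a) (c b)
    rw [QuotientGroup.leftRel_apply, QuotientGroup.leftRel_apply, Subgroup.mem_subgroupOf,
      Subgroup.mem_subgroupOf, hS', Subgroup.mem_map_equiv, MulAut.conj_symm_apply]
    simp [hc, mul_assoc])
  rw [relTrace_apply, relTrace_apply]
  have := Fintype.ofFinite (Q ⧸ S.subgroupOf Q)
  have := Fintype.ofFinite (Q ⧸ S'.subgroupOf Q)
  rw [finsum_eq_sum_of_fintype, finsum_eq_sum_of_fintype, map_sum]
  refine Fintype.sum_equiv e _ _ fun x => ?_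
  induction x using QuotientGroup.induction_on with
  | H q =>
    have he : e (QuotientGroup.mk q) = QuotientGroup.mk (c q) := rfl
    rw [he, apply_out ρ hm, apply_out ρ (apply_mem_fixedPoints_map ρ g hm), hc,
      ← Module.End.mul_apply, ← Module.End.mul_apply, ← map_mul, ← map_mul]
    congr 2
    group

lemma apply_mem_fixedPoints {Q : Subgroup G} {g : G}
    (hg : g ∈ Subgroup.normalizer (Q : Set G)) {m : V} (hm : m ∈ fixedPoints ρ Q) :
    ρ g m ∈ fixedPoints ρ Q := by
  simpa only [map_conj_of_mem_normalizer hg] using apply_mem_fixedPoints_map ρ g hm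

lemma properTraces_le_comap {Q : Subgroup G} {g : G}
    (hg : g ∈ Subgroup.normalizer (Q : Set G)) :
    properTraces ρ Q ≤ (properTraces ρ Q).comap (ρ g) := by
  refine iSup₂_le fun S hS => ?_
  rintro _ ⟨m, hm, rfl⟩
  have hlt : S.map (MulAut.conj g).toMonoidHom < Q := by
    have h := (Subgroup.map_lt_map_iff_of_injective
      (f := (MulAut.conj g).toMonoidHom) (MulAut.conj g).injective).2 hS
    rwa [map_conj_of_mem_normalizer hg] at h
  rw [Submodule.mem_comap, apply_relTrace ρ hg hm]
  exact (le_iSup₂_of_le (f := fun (S : Subgroup G) (_ : S < Q) => traceImage ρ S Q) _ hlt le_rfl)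
    ⟨_, apply_mem_fixedPoints_map ρ g hm, rfl⟩

/-- `M ^ Q` as a `k N_G(Q)`-module. -/
noncomputable def fixedPointsRep (Q : Subgroup G) :
    Representation k (Subgroup.normalizer (Q : Set G)) (fixedPoints ρ Q) :=
  (resSubgroup ρ (Subgroup.normalizer (Q : Set G))).subrepresentation (fixedPoints ρ Q)
    fun g _ hm => apply_mem_fixedPoints ρ g.2 hm

/-- The underlying space of the Brauer construction `M(Q) = M ^ Q / ∑_{S < Q} M_S ^ Q`. -/
abbrev BrauerQuotient (Q : Subgroup G) : Type _ :=
  fixedPoints ρ Q ⧸ (properTraces ρ Q).comap (fixedPoints ρ Q).subtype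

/-- The Brauer construction `M(Q)` as a `k N_G(Q)`-module. -/
noncomputable def brauer (Q : Subgroup G) :
    Representation k (Subgroup.normalizer (Q : Set G)) (BrauerQuotient ρ Q) :=
  (fixedPointsRep ρ Q).quotient ((properTraces ρ Q).comap (fixedPoints ρ Q).subtype)
    fun g m hm => by
      have h : ρ (g : G) (m : V) ∈ properTraces ρ Q := properTraces_le_comap ρ g.2 hm
      exact h

/-- `M` is Brauer indecomposable: for each `p`-subgroup `Q` of `G`, the restriction of `M(Q)` from
`N_G(Q)` to `Q C_G(Q)` is indecomposable or zero. -/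
def IsBrauerIndecomposable (p : ℕ) : Prop :=
  ∀ Q : Subgroup G, IsPGroup p Q →
    IsIndecomposable
      ((brauer ρ Q).comp (Subgroup.inclusion (sup_centralizer_le_normalizer Q))) ∨
    Subsingleton (BrauerQuotient ρ Q)

end Brauer

/-! ### The fusion system `F_P(G)` and saturation -/

section Fusion

variable {G : Type*} [Group G]

/-- `Hom_G(Q, R)`: the homomorphisms `Q → R` induced by conjugation by an element of `G`. For
`Q, R ≤ P` this is the set of morphisms from `Q` to `R` in the fusion system `F_P(G)`. -/
def homG (Q R : Subgroup G) : Set (Q →* R) :=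
  {φ | ∃ g : G, ∀ x : Q, (φ x : G) = g * x * g⁻¹}

/-- `Aut_H(Q)`: the automorphisms of `Q` induced by conjugation by elements of `N_H(Q)`. For
`H = G` this is the automorphism group of `Q` in `F_P(G)`. -/
def autOf (H Q : Subgroup G) : Subgroup (MulAut Q) :=
  (H.subgroupOf (Subgroup.normalizer (Q : Set G))).map Q.normalizerMonoidHom

/-- `Q ≤ P` is fully automized in `F_P(G)`: `Aut_P(Q)` is a Sylow `p`-subgroup of `Aut_G(Q)`. -/
def IsFullyAutomized (p : ℕ) (P Q : Subgroup G) : Prop :=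
  ∃ S : Sylow p (autOf ⊤ Q), (S : Subgroup (autOf ⊤ Q)) = (autOf P Q).subgroupOf (autOf ⊤ Q)

/-- For an isomorphism `φ : R → Q` between subgroups of `P`, the subgroup
`N_φ = {g ∈ N_P(R) | φ ∘ c_g ∘ φ⁻¹ ∈ Aut_P(Q)}`, where `c_g` is conjugation by `g`. -/
def extender (P : Subgroup G) {R Q : Subgroup G} (φ : R ≃* Q) : Subgroup G :=
  P ⊓ ((autOf P Q).comap ((MulAut.congr φ).toMonoidHom.comp R.normalizerMonoidHom)).map
    (Subgroup.normalizer (R : Set G)).subtype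

/-- `Q ≤ P` is receptive in `F_P(G)`: each isomorphism `φ : R → Q` of `F_P(G)` extends to a
morphism `N_φ → P` of `F_P(G)`. -/
def IsReceptive (P Q : Subgroup G) : Prop :=
  ∀ R : Subgroup G, R ≤ P → ∀ φ : R ≃* Q, φ.toMonoidHom ∈ homG R Q →
    ∃ ψ ∈ homG (extender P φ) P,
      ∀ (x : G) (hx : x ∈ R) (hx' : x ∈ extender P φ), (ψ ⟨x, hx'⟩ : G) = φ ⟨x, hx⟩

/-- The fusion system `F_P(G)` is saturated: each subgroup of `P` is isomorphic in `F_P(G)` to a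
subgroup of `P` that is fully automized and receptive. -/
def IsSaturated (p : ℕ) (P : Subgroup G) : Prop :=
  ∀ Q : Subgroup G, Q ≤ P → ∃ Q' : Subgroup G, Q' ≤ P ∧
    (∃ φ : Q ≃* Q', φ.toMonoidHom ∈ homG Q Q') ∧ IsFullyAutomized p P Q' ∧ IsReceptive P Q'

/-- `N_φ` contains the domain `R` of `φ`, so the morphisms `N_φ → P` above really extend `φ`. -/
lemma le_extender {P R Q : Subgroup G} (hR : R ≤ P) (hQ : Q ≤ P) (φ : R ≃* Q) :
    R ≤ extender P φ := by
  intro x hx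
  refine ⟨hR hx, ⟨⟨x, Subgroup.le_normalizer hx⟩, ?_, rfl⟩⟩
  refine ⟨⟨φ ⟨x, hx⟩, Subgroup.le_normalizer (φ ⟨x, hx⟩).2⟩,
    Subgroup.mem_subgroupOf.2 (hQ (φ ⟨x, hx⟩).2), ?_⟩
  ext y
  have h : (MulAut.congr φ) (R.normalizerMonoidHom ⟨x, Subgroup.le_normalizer hx⟩) y
      = φ ⟨x, hx⟩ * y * (φ ⟨x, hx⟩)⁻¹ := by
    change φ (⟨x, hx⟩ * φ.symm y * ⟨x, hx⟩⁻¹) = _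
    simp
  change _ = (((MulAut.congr φ) (R.normalizerMonoidHom ⟨x, Subgroup.le_normalizer hx⟩) y : Q) : G)
  rw [h]
  rfl

end Fusion

end BrauerScott

/-! Write `M` as a direct summand of the permutation module on `X = G ⧸ P`, and let `ε`
(`PermFrame.aug`) be the restriction to `M` of the augmentation. The fixed vector in `M` forces `ε`
to be `1` on the image of each point of `X` (`PermFrame.aug_vec`), while `ε` kills all proper
relative traces of `p`-subgroups. Nonvanishing of `ε` is thus a certificate of non-nilpotence, to be
fed into Fitting's lemma.

A `p`-subgroup `Q` without fixed points on `X` has `M(Q) = 0`. Otherwise `Q` lies in a conjugate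
`P'` of `P`, and `R ≤ P'` because `R` is normal.

If `QR = P'`, then `M(Q)` and `M(P')` are the same section of `M`, since `R` acts trivially on `M`
and on `X`. This section is generated over `N_G(P')` by any element with `ε ≠ 0`
(`PermFrame.eq_fixedPoints_of_aug_ne_zero`), and by saturation the index of `P' C_G(P')` in
`N_G(P')` is prime to `p`. An averaging argument then gives the section a unique maximal submodule
already over `P' C_G(P')` (`sectionIndecomposable_of_generated`).

If `QR < P'`, then up to conjugation `QR` lies in a maximal subgroup `T ≥ R` of `P`.
Indecomposability over `C_G(T)` forces `T` to act trivially on `M`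
(`PermFrame.apply_eq_self_of_isIndecomposable`). So `M(Q) = M`, and the hypothesis on `T` applies
directly. -/

namespace BrauerScott

/-! ### Indecomposable sections of a module, and Fitting's lemma -/

section Section

variable {k G V : Type*} [Field k] [Group G] [AddCommGroup V] [Module k V]
  (ρ : Representation k G V)

/-- The subspace `A` is stable under the subgroup `H`. -/
def IsStable (H : Subgroup G) (A : Submodule k V) : Prop :=
  ∀ h ∈ H, ∀ a ∈ A, ρ h a ∈ A

/-- The section `F / Z` is not the direct sum of two nonzero `kH`-submodules. -/
def SectionIndecomposable (H : Subgroup G) (Z F : Submodule k V) : Prop :=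
  ∀ A B : Submodule k V, IsStable ρ H A → IsStable ρ H B → Z ≤ A → Z ≤ B →
    A ⊔ B = F → A ⊓ B = Z → A = Z ∨ B = Z

variable {ρ}

lemma IsStable.mono {H K : Subgroup G} {A : Submodule k V} (h : IsStable ρ K A) (hHK : H ≤ K) :
    IsStable ρ H A := fun x hx => h x (hHK hx)

lemma IsStable.inf {H : Subgroup G} {A B : Submodule k V} (hA : IsStable ρ H A)
    (hB : IsStable ρ H B) : IsStable ρ H (A ⊓ B) :=
  fun h hh a ha => ⟨hA h hh a ha.1, hB h hh a ha.2⟩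

lemma IsStable.sup {H : Subgroup G} {A B : Submodule k V} (hA : IsStable ρ H A)
    (hB : IsStable ρ H B) : IsStable ρ H (A ⊔ B) := by
  intro h hh v hv
  obtain ⟨a, ha, b, hb, rfl⟩ := Submodule.mem_sup.1 hv
  rw [map_add]
  exact Submodule.add_mem_sup (hA h hh a ha) (hB h hh b hb)

lemma isStable_ker {H : Subgroup G} {ε : V →ₗ[k] k} (hε : ∀ h ∈ H, ∀ v, ε (ρ h v) = ε v) :
    IsStable ρ H (LinearMap.ker ε) := fun h hh a ha => by
  rw [LinearMap.mem_ker] at ha ⊢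
  rw [hε h hh, ha]

lemma SectionIndecomposable.mono {H K : Subgroup G} {Z F : Submodule k V}
    (h : SectionIndecomposable ρ H Z F) (hHK : H ≤ K) : SectionIndecomposable ρ K Z F :=
  fun A B hA hB => h A B (hA.mono hHK) (hB.mono hHK)

lemma apply_inv_apply (g : G) (v : V) : ρ g⁻¹ (ρ g v) = v := by simp

lemma apply_apply_inv (g : G) (v : V) : ρ g (ρ g⁻¹ v) = v := by simp

/-- If the section `F / Z` is generated over `N` by each of its elements on which the invariant
functional `ε` does not vanish, then it is indecomposable over each normal subgroup of `N` whose
index is invertible in `k`. -/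
theorem sectionIndecomposable_of_generated [Finite G] [FiniteDimensional k V] {H N : Subgroup G}
    (hHN : H ≤ N) (hnorm : ∀ n ∈ N, ∀ h ∈ H, n * h * n⁻¹ ∈ H)
    (hidx : (H.relIndex N : k) ≠ 0) {ε : V →ₗ[k] k} (hε : ∀ n ∈ N, ∀ v, ε (ρ n v) = ε v)
    {Z₀ F : Submodule k V} (hZF : Z₀ ≤ F) (hZ : IsStable ρ N Z₀) (hF : IsStable ρ N F)
    (hZε : ∀ z ∈ Z₀, ε z = 0) (hFε : ∃ a ∈ F, ε a ≠ 0)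
    (hgen : ∀ A, IsStable ρ N A → Z₀ ≤ A → A ≤ F → (∃ a ∈ A, ε a ≠ 0) → A = F) :
    SectionIndecomposable ρ H Z₀ F := by
  classical
  let P : Submodule k V → Prop := fun X => IsStable ρ H X ∧ Z₀ ≤ X ∧ X < F
  have hPcomap : ∀ n ∈ N, ∀ X, P X → P (X.comap (ρ n)) := by
    rintro n hn X ⟨h1, h2, h3⟩
    have hle : X.comap (ρ n) ≤ F := fun a ha => by
      simpa using hF n⁻¹ (N.inv_mem hn) _ (h3.le ha)
    refine ⟨fun h hh a ha => ?_, fun a ha => h2 (hZ n hn a ha), lt_of_le_of_ne hle fun he => ?_⟩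
    · have := h1 _ (hnorm n hn h hh) _ ha
      rw [← Module.End.mul_apply, ← map_mul] at this
      rw [Submodule.mem_comap, ← Module.End.mul_apply, ← map_mul]
      simpa using this
    · refine h3.not_ge fun f hf => ?_
      have : ρ n⁻¹ f ∈ X.comap (ρ n) := he ▸ hF n⁻¹ (N.inv_mem hn) f hf
      rwa [Submodule.mem_comap, apply_apply_inv] at this
  have hmaxcomap : ∀ n ∈ N, ∀ X, Maximal P X → Maximal P (X.comap (ρ n)) := by
    refine fun n hn X hX => ⟨hPcomap n hn X hX.1, fun Y hY hXY y hy => ?_⟩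
    have hle : X ≤ Y.comap (ρ n⁻¹) := fun x hx => hXY (by
      rwa [Submodule.mem_comap, apply_apply_inv])
    refine hX.2 (hPcomap n⁻¹ (N.inv_mem hn) Y hY) hle ?_
    rwa [Submodule.mem_comap, apply_inv_apply]
  -- `Z / Z₀` is the radical of `F / Z₀` over `H`. It is `N`-stable because `N` normalizes `H` and
  -- so permutes the maximal `H`-submodules.
  let Z : Submodule k V := F ⊓ sInf {X | Maximal P X}
  have hmemZ : ∀ v, v ∈ Z ↔ v ∈ F ∧ ∀ X, Maximal P X → v ∈ X := fun v => by
    simp [Z]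
  have hZN : IsStable ρ N Z := fun n hn z hz => by
    rw [hmemZ] at hz ⊢
    exact ⟨hF n hn z hz.1, fun X hX => hz.2 _ (hmaxcomap n hn X hX)⟩
  have hZ₀Z : Z₀ ≤ Z := fun z hz => (hmemZ z).2 ⟨hZF hz, fun X hX => hX.1.2.1 hz⟩
  let I : Submodule k V := F ⊓ LinearMap.ker ε
  have hεH : ∀ h ∈ H, ∀ v, ε (ρ h v) = ε v := fun h hh => hε h (hHN hh)
  obtain ⟨a₀, ha₀F, ha₀⟩ := hFε
  have hPI : P I := by
    refine ⟨(hF.mono hHN).inf (isStable_ker hεH), fun z hz => ⟨hZF hz, hZε z hz⟩,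
      lt_of_le_of_ne inf_le_left fun he => ha₀ ?_⟩
    have : a₀ ∈ I := he ▸ ha₀F
    exact this.2
  have hImax : Maximal P I := by
    refine ⟨hPI, fun Y hY hIY y hy => ⟨hY.2.2.le hy, ?_⟩⟩
    by_contra hεy
    replace hεy : ε y ≠ 0 := hεy
    refine hY.2.2.not_ge fun f hf => ?_
    have h1 : f - (ε f / ε y) • y ∈ I :=
      ⟨F.sub_mem hf (F.smul_mem _ (hY.2.2.le hy)), by simp [hεy]⟩
    simpa using Y.add_mem (hIY h1) (Y.smul_mem (ε f / ε y) hy)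
  let Q : Submodule k V → Prop := fun C => IsStable ρ H C ∧ Z₀ ≤ C ∧ C ≤ F ∧ ∃ a ∈ C, ε a ≠ 0
  obtain ⟨C, hC⟩ := exists_minimal_of_wellFoundedLT Q ⟨F, hF.mono hHN, hZF, le_rfl, a₀, ha₀F, ha₀⟩
  obtain ⟨c, hcC, hc⟩ := hC.1.2.2.2
  -- If a maximal `X` missed such a `y`, then `X + (C ∩ ker ε) = F`, so `ε` would not vanish on `C ∩
  -- X`, and minimality would put `C` inside `X`. Consequently `c` is fixed by `H` modulo `Z`.
  have hCI : ∀ y ∈ C, ε y = 0 → y ∈ Z := by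
    refine fun y hy hy0 => (hmemZ y).2 ⟨hC.1.2.2.1 hy, fun X hX => ?_⟩
    by_contra hyX
    have hsup : X ⊔ (C ⊓ LinearMap.ker ε) = F := by
      by_contra hne
      have hP : P (X ⊔ (C ⊓ LinearMap.ker ε)) :=
        ⟨hX.1.1.sup (hC.1.1.inf (isStable_ker hεH)), hX.1.2.1.trans le_sup_left,
          lt_of_le_of_ne (sup_le hX.1.2.2.le (inf_le_left.trans hC.1.2.2.1)) hne⟩
      exact hyX (hX.2 hP le_sup_left (Submodule.mem_sup_right ⟨hy, hy0⟩))
    have hcF : c ∈ X ⊔ (C ⊓ LinearMap.ker ε) := hsup ▸ hC.1.2.2.1 hcC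
    obtain ⟨x, hx, y', hy', hxy⟩ := Submodule.mem_sup.1 hcF
    have hxC : x ∈ C := by
      rw [← eq_sub_iff_add_eq] at hxy
      exact hxy ▸ C.sub_mem hcC hy'.1
    have hεx : ε x ≠ 0 := by
      have : ε y' = 0 := hy'.2
      rw [← hxy, map_add, this, add_zero] at hc
      exact hc
    have hQ : Q (C ⊓ X) := ⟨hC.1.1.inf hX.1.1, le_inf hC.1.2.1 hX.1.2.1,
      inf_le_left.trans hC.1.2.2.1, x, ⟨hxC, hx⟩, hεx⟩
    exact hyX (hC.2 hQ inf_le_left hy).2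
  have := Fintype.ofFinite (N ⧸ H.subgroupOf N)
  -- The trace of `c` from `H` to `N`: fixed by `N` modulo `Z`, with `ε w = [N : H] ε c`, which is
  -- where the invertible index enters.
  let w : V := ∑ q : N ⧸ H.subgroupOf N, ρ ((q.out : N) : G) c
  have hout : ∀ n : N, ρ (n : G) c -
      ρ (((QuotientGroup.mk n : N ⧸ H.subgroupOf N).out : N) : G) c ∈ Z := by
    intro n
    obtain ⟨h, hh⟩ := QuotientGroup.mk_out_eq_mul (H.subgroupOf N) n
    have hhH : ((h : N) : G) ∈ H := Subgroup.mem_subgroupOf.1 h.2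
    rw [hh, Subgroup.coe_mul, map_mul, Module.End.mul_apply, ← map_sub]
    refine hZN n n.2 _ (hCI _ (C.sub_mem hcC (hC.1.1 _ hhH _ hcC)) ?_)
    rw [map_sub, hεH _ hhH, sub_self]
  have hw : ∀ n ∈ N, ρ n w - w ∈ Z := by
    intro n hn
    have h1 : w = ∑ q : N ⧸ H.subgroupOf N, ρ ((((⟨n, hn⟩ : N) • q).out : N) : G) c :=
      (Equiv.sum_comp (MulAction.toPerm (⟨n, hn⟩ : N))
        (fun q : N ⧸ H.subgroupOf N => ρ ((q.out : N) : G) c)).symm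
    have h2 : ρ n w - w = ∑ q : N ⧸ H.subgroupOf N, (ρ ((⟨n, hn⟩ * q.out : N) : G) c -
        ρ ((((⟨n, hn⟩ : N) • q).out : N) : G) c) := by
      rw [Finset.sum_sub_distrib, ← h1]
      simp [w, map_sum]
    rw [h2]
    refine Z.sum_mem fun q _ => ?_
    convert hout (⟨n, hn⟩ * q.out) using 5
    conv_lhs => rw [← QuotientGroup.out_eq' q]
    rfl
  have hcF : c ∈ F := hC.1.2.2.1 hcC
  have hεw : ε w ≠ 0 := by
    have : ε w = (H.relIndex N : k) * ε c := by
      simp only [w, map_sum]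
      rw [Finset.sum_congr rfl fun q _ => hε _ (q.out : N).2 c]
      simp [Subgroup.relIndex, Subgroup.index, Nat.card_eq_fintype_card]
    rw [this]
    exact mul_ne_zero hidx hc
  have hwF : w ∈ F := F.sum_mem fun q _ => hF _ (q.out : N).2 _ hcF
  -- The span of `w` and `Z` is `N`-stable, so the generation hypothesis applies. Hence the top `F /
  -- Z` is one-dimensional.
  have hD : Submodule.span k {w} ⊔ Z = F := by
    refine hgen _ ?_ (hZ₀Z.trans le_sup_right) (sup_le ?_ inf_le_left)
      ⟨w, Submodule.mem_sup_left (Submodule.mem_span_singleton_self w), hεw⟩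
    · intro n hn v hv
      obtain ⟨a, ha, z, hz, rfl⟩ := Submodule.mem_sup.1 hv
      obtain ⟨t, rfl⟩ := Submodule.mem_span_singleton.1 ha
      have : ρ n (t • w + z) = t • w + (t • (ρ n w - w) + ρ n z) := by
        rw [map_add, map_smul, smul_sub]; abel
      rw [this]
      exact Submodule.add_mem_sup ha (Z.add_mem (Z.smul_mem _ (hw n hn)) (hZN n hn z hz))
    · rwa [Submodule.span_singleton_le_iff_mem]
  have hZI : ∀ v ∈ F, ε v = 0 → v ∈ Z := by
    intro v hv hv0
    rw [← hD] at hv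
    obtain ⟨a, ha, z, hz, rfl⟩ := Submodule.mem_sup.1 hv
    obtain ⟨t, rfl⟩ := Submodule.mem_span_singleton.1 ha
    have hz0 : ε z = 0 := (((hmemZ z).1 hz).2 I hImax).2
    rw [map_add, hz0, add_zero, map_smul, smul_eq_mul] at hv0
    rcases mul_eq_zero.1 hv0 with h | h
    · simpa [h] using hz
    · exact absurd h hεw
  -- `I` is the only maximal `H`-submodule, so two proper submodules cannot sum to `F`.
  have hle : ∀ X, P X → X ≤ I := by
    intro X hX
    obtain ⟨Y, hXY, hY⟩ := exists_maximal_ge_of_wellFoundedGT P X hX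
    have : I ≤ Y := fun v hv => ((hmemZ v).1 (hZI v hv.1 hv.2)).2 Y hY
    exact hXY.trans (hImax.2 hY.1 this)
  intro A B hA hB hZA hZB hAB hABZ
  by_contra! hne
  have hAF : P A := ⟨hA, hZA, lt_of_le_of_ne (hAB ▸ le_sup_left) fun he => hne.2 (by
    rw [← hABZ, he, eq_comm, inf_eq_right, ← hAB]; exact le_sup_right)⟩
  have hBF : P B := ⟨hB, hZB, lt_of_le_of_ne (hAB ▸ le_sup_right) fun he => hne.1 (by
    rw [← hABZ, he, eq_comm, inf_eq_left, ← hAB]; exact le_sup_left)⟩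
  have hFI : F ≤ I := hAB ▸ sup_le (hle A hAF) (hle B hBF)
  exact ha₀ (hFI ha₀F).2

lemma isIndecomposable_resSubgroup_iff {H : Subgroup G} :
    IsIndecomposable (resSubgroup ρ H) ↔ Nontrivial V ∧ SectionIndecomposable ρ H ⊥ ⊤ := by
  refine and_congr_right fun _ => ⟨fun h A B hA hB _ _ hs hi => ?_, fun h U W hc => ?_⟩
  · let U : Subrepresentation (resSubgroup ρ H) := ⟨A, fun g v hv => hA g g.2 v hv⟩
    let W : Subrepresentation (resSubgroup ρ H) := ⟨B, fun g v hv => hB g g.2 v hv⟩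
    have hUW : IsCompl U W := by
      refine ⟨disjoint_iff.2 (Subrepresentation.toSubmodule_injective hi),
        codisjoint_iff.2 (Subrepresentation.toSubmodule_injective hs)⟩
    exact (h U W hUW).imp (fun e => congrArg Subrepresentation.toSubmodule e)
      (fun e => congrArg Subrepresentation.toSubmodule e)
  · have hs := congrArg Subrepresentation.toSubmodule hc.sup_eq_top
    have hi := congrArg Subrepresentation.toSubmodule hc.inf_eq_bot
    exact (h U.toSubmodule W.toSubmodule (fun g hg v hv => U.apply_mem_toSubmodule ⟨g, hg⟩ hv)
      (fun g hg v hv => W.apply_mem_toSubmodule ⟨g, hg⟩ hv) bot_le bot_le hs hi).imp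
      (fun e => Subrepresentation.toSubmodule_injective e)
      (fun e => Subrepresentation.toSubmodule_injective e)

/-- Fitting's lemma: an endomorphism of an indecomposable module that is not nilpotent is
bijective. -/
lemma bijective_of_commute [FiniteDimensional k V] {H : Subgroup G}
    (hV : SectionIndecomposable ρ H ⊥ ⊤) {φ : V →ₗ[k] V}
    (hφ : ∀ h ∈ H, ∀ v, φ (ρ h v) = ρ h (φ v)) {v : V} (hv : ∀ n : ℕ, (φ ^ n) v ≠ 0) :
    Function.Bijective φ := by
  have hpow : ∀ (n : ℕ), ∀ h ∈ H, ∀ v, (φ ^ n) (ρ h v) = ρ h ((φ ^ n) v) := by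
    intro n h hh v
    induction n with
    | zero => simp
    | succ n ih => rw [pow_succ', Module.End.mul_apply, ih, hφ h hh, Module.End.mul_apply]
  have hc := φ.isCompl_iSup_ker_pow_iInf_range_pow
  obtain ⟨n, hn⟩ := φ.eventually_iSup_ker_pow_eq.exists
  rw [hn] at hc
  have hker : IsStable ρ H (LinearMap.ker (φ ^ n)) := fun h hh a ha => by
    rw [LinearMap.mem_ker] at ha ⊢
    rw [hpow n h hh, ha, map_zero]
  have hrange : IsStable ρ H (⨅ m, LinearMap.range (φ ^ m)) := fun h hh a ha => by
    rw [Submodule.mem_iInf] at ha ⊢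
    intro m
    obtain ⟨b, rfl⟩ := ha m
    exact ⟨ρ h b, hpow m h hh b⟩
  -- One Fitting summand is zero: either `φ` is injective, or `φ ^ n` kills `v`.
  rcases hV _ _ hker hrange bot_le bot_le hc.sup_eq_top hc.inf_eq_bot with h | h
  · have hinj : Function.Injective φ := by
      rw [← LinearMap.ker_eq_bot, eq_bot_iff, ← h, ← hn]
      exact le_iSup_of_le (f := fun n => LinearMap.ker (φ ^ n)) 1 (by rw [pow_one])
    exact ⟨hinj, LinearMap.injective_iff_surjective.1 hinj⟩
  · rw [h] at hc
    have hv' : v ∈ LinearMap.ker (φ ^ n) ⊔ ⊥ := hc.sup_eq_top ▸ Submodule.mem_top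
    rw [sup_bot_eq] at hv'
    exact absurd hv' (hv n)

end Section

/-! ### The Brauer quotient as a section of `M` -/

section BrauerQuotient

variable {k G V : Type*} [Field k] [Group G] [AddCommGroup V] [Module k V]
  {ρ : Representation k G V}

lemma subsingleton_brauerQuotient {Q : Subgroup G} (h : fixedPoints ρ Q ≤ properTraces ρ Q) :
    Subsingleton (BrauerQuotient ρ Q) := by
  rw [Submodule.Quotient.subsingleton_iff, eq_top_iff]
  exact fun x _ => h x.2

variable [Finite G]

lemma isStable_fixedPoints (Q : Subgroup G) :
    IsStable ρ (Subgroup.normalizer (Q : Set G)) (fixedPoints ρ Q) :=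
  fun _ hg _ ha => apply_mem_fixedPoints ρ hg ha

lemma isStable_properTraces (Q : Subgroup G) :
    IsStable ρ (Subgroup.normalizer (Q : Set G)) (properTraces ρ Q) :=
  fun _ hg _ ha => properTraces_le_comap ρ hg ha

/-- Indecomposability of `M(Q)` over `Q C_G(Q)` in terms of subspaces of `M`. -/
lemma isIndecomposable_brauer {Q : Subgroup G} (hle : properTraces ρ Q ≤ fixedPoints ρ Q)
    {v : V} (hv : v ∈ fixedPoints ρ Q) (hv' : v ∉ properTraces ρ Q)
    (h : SectionIndecomposable ρ (Q ⊔ Subgroup.centralizer (Q : Set G))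
      (properTraces ρ Q) (fixedPoints ρ Q)) :
    IsIndecomposable
      ((brauer ρ Q).comp (Subgroup.inclusion (sup_centralizer_le_normalizer Q))) := by
  set K := Q ⊔ Subgroup.centralizer (Q : Set G)
  set F := fixedPoints ρ Q
  set Z := properTraces ρ Q
  set σ := (brauer ρ Q).comp (Subgroup.inclusion (sup_centralizer_le_normalizer Q))
  let π : F →ₗ[k] BrauerQuotient ρ Q := (Z.comap F.subtype).mkQ
  have hπ : ∀ x, π x = 0 ↔ (x : V) ∈ Z := fun x => by simp [π]
  have hsurj : Function.Surjective π := Submodule.mkQ_surjective _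
  have hσ : ∀ (g : K) (x : F) (hx : ρ (g : G) (x : V) ∈ F), σ g (π x) = π ⟨ρ g x, hx⟩ :=
    fun g x hx => rfl
  refine ⟨⟨π ⟨v, hv⟩, 0, fun h0 => hv' ((hπ _).1 h0)⟩, fun U W hUW => ?_⟩
  -- The preimage in `V` turns a decomposition of `M(Q)` into one of the section `F / Z`.
  let L : Submodule k (BrauerQuotient ρ Q) → Submodule k V := fun U => (U.comap π).map F.subtype
  have hL : ∀ U (x : V), x ∈ L U ↔ ∃ hx : x ∈ F, π ⟨x, hx⟩ ∈ U := fun U x => by simp [L]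
  have hLZ : ∀ U, Z ≤ L U := fun U x hx => (hL U x).2 ⟨hle hx, by
    rw [(hπ _).2 hx]; exact U.zero_mem⟩
  have hLbot : ∀ U, L U = Z → U = ⊥ := by
    intro U hU
    rw [eq_bot_iff]
    intro u hu
    obtain ⟨x, rfl⟩ := hsurj u
    exact (hπ x).2 (hU ▸ (hL U x).2 ⟨x.2, hu⟩)
  have hLst : ∀ U : Subrepresentation σ, IsStable ρ K (L U.toSubmodule) := by
    intro U g hg x hx
    obtain ⟨hxF, hxU⟩ := (hL _ x).1 hx
    have hgx : ρ g x ∈ F := isStable_fixedPoints Q g (sup_centralizer_le_normalizer Q hg) x hxF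
    exact (hL _ _).2 ⟨hgx, U.apply_mem_toSubmodule ⟨g, hg⟩ hxU⟩
  have hs := congrArg Subrepresentation.toSubmodule hUW.sup_eq_top
  have hi := congrArg Subrepresentation.toSubmodule hUW.inf_eq_bot
  refine (h (L U.toSubmodule) (L W.toSubmodule) (hLst U) (hLst W) (hLZ _) (hLZ _) ?_ ?_).imp
    (fun e => Subrepresentation.toSubmodule_injective (hLbot _ e))
    (fun e => Subrepresentation.toSubmodule_injective (hLbot _ e))
  · refine le_antisymm (sup_le (fun x hx => ((hL _ x).1 hx).1) fun x hx => ((hL _ x).1 hx).1) ?_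
    intro x hx
    have hx' : π ⟨x, hx⟩ ∈ U.toSubmodule ⊔ W.toSubmodule := by
      rw [← Subrepresentation.toSubmodule_sup, hs]; trivial
    obtain ⟨u, hu, w, hw, huw⟩ := Submodule.mem_sup.1 hx'
    obtain ⟨a, rfl⟩ := hsurj u
    have hb : π (⟨x, hx⟩ - a) ∈ W.toSubmodule := by
      rw [map_sub, ← huw, add_sub_cancel_left]; exact hw
    have hxe : x = a + (x - a) := by abel
    rw [hxe]
    exact Submodule.add_mem_sup ((hL _ _).2 ⟨a.2, hu⟩) ((hL _ _).2 ⟨F.sub_mem hx a.2, hb⟩)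
  · refine le_antisymm (fun x hx => ?_) (le_inf (hLZ _) (hLZ _))
    obtain ⟨hxF, hxU⟩ := (hL _ x).1 hx.1
    obtain ⟨_, hxW⟩ := (hL _ x).1 hx.2
    have : π ⟨x, hxF⟩ ∈ (U ⊓ W).toSubmodule := ⟨hxU, hxW⟩
    rw [hi] at this
    exact (hπ _).1 this

end BrauerQuotient

end BrauerScott

namespace BrauerScott

/-! ### Relative traces and orbit sums -/

section Traces

variable {k G V X : Type*} [Field k] [Group G] [Finite G] [AddCommGroup V] [Module k V]
  {ρ : Representation k G V} [MulAction G X]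

lemma properTraces_le_fixedPoints (Q : Subgroup G) : properTraces ρ Q ≤ fixedPoints ρ Q := by
  refine iSup₂_le fun S hS => ?_
  rintro _ ⟨m, hm, rfl⟩
  rw [mem_fixedPoints]
  intro q hq
  have := Fintype.ofFinite (Q ⧸ S.subgroupOf Q)
  rw [relTrace_apply, finsum_eq_sum_of_fintype, map_sum]
  refine Fintype.sum_equiv (MulAction.toPerm (⟨q, hq⟩ : Q)) _ _ fun x => ?_
  induction x using QuotientGroup.induction_on with
  | H y =>
    have h : MulAction.toPerm (⟨q, hq⟩ : Q) (QuotientGroup.mk y : Q ⧸ S.subgroupOf Q) =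
      QuotientGroup.mk (⟨q, hq⟩ * y) := rfl
    rw [h, apply_out ρ hm, apply_out ρ hm, Subgroup.coe_mul, map_mul, Module.End.mul_apply]

/-- An invariant functional turns a relative trace from `S` into multiplication by `[Q : S]`, a
positive power of `p` when `S < Q`. -/
lemma eq_zero_of_mem_properTraces {p : ℕ} [Fact p.Prime] [CharP k p] {Q : Subgroup G}
    (hQ : IsPGroup p Q) {f : V →ₗ[k] k} (hf : ∀ q ∈ Q, ∀ v, f (ρ q v) = f v) {v : V}
    (hv : v ∈ properTraces ρ Q) : f v = 0 := by
  suffices properTraces ρ Q ≤ LinearMap.ker f from this hv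
  refine iSup₂_le fun S hS => ?_
  rintro _ ⟨m, hm, rfl⟩
  have := Fintype.ofFinite (Q ⧸ S.subgroupOf Q)
  rw [LinearMap.mem_ker, relTrace_apply, finsum_eq_sum_of_fintype, map_sum,
    Finset.sum_congr rfl fun x _ => hf _ (x.out : Q).2 m, Finset.sum_const, nsmul_eq_mul,
    Finset.card_univ, ← Nat.card_eq_fintype_card]
  obtain ⟨n, hn⟩ := hQ.index (S.subgroupOf Q)
  have hn0 : n ≠ 0 := by
    rintro rfl
    rw [pow_zero, Subgroup.index_eq_one, Subgroup.subgroupOf_eq_top] at hn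
    exact hS.not_ge hn
  rw [← Subgroup.index, hn, Nat.cast_pow, CharP.cast_eq_zero, zero_pow hn0, zero_mul]

/-- An orbit sum is the relative trace of `w x` from the stabilizer of `x` in `Q`, which is proper
as `x` is moved. -/
lemma sum_orbit_mem_properTraces {Q : Subgroup G} {w : X → V}
    (hw : ∀ q ∈ Q, ∀ x, ρ q (w x) = w (q • x)) {x : X} (hx : ∃ q ∈ Q, q • x ≠ x)
    {O : Finset X} (hO : ∀ y, y ∈ O ↔ ∃ q ∈ Q, q • x = y) :
    ∑ y ∈ O, w y ∈ properTraces ρ Q := by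
  let S : Subgroup G := MulAction.stabilizer G x ⊓ Q
  have hSQ : S < Q := by
    refine lt_of_le_of_ne inf_le_right fun h => ?_
    obtain ⟨q, hq, hne⟩ := hx
    rw [← h] at hq
    exact hne hq.1
  have hwS : w x ∈ fixedPoints ρ S := mem_fixedPoints.2 fun q hq => by
    rw [hw q hq.2, (MulAction.mem_stabilizer_iff.1 hq.1)]
  have := Fintype.ofFinite (Q ⧸ S.subgroupOf Q)
  have key : ∑ y ∈ O, w y = relTrace ρ S Q (w x) := by
    rw [relTrace_apply, finsum_eq_sum_of_fintype]
    symm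
    refine Finset.sum_bij (fun z _ => ((z.out : Q) : G) • x) (fun z _ => ?_) (fun z _ z' _ h => ?_)
      (fun y hy => ?_) (fun z _ => hw _ (z.out : Q).2 x)
    · exact (hO _).2 ⟨_, (z.out : Q).2, rfl⟩
    · rw [← QuotientGroup.out_eq' z, ← QuotientGroup.out_eq' z', QuotientGroup.eq,
        Subgroup.mem_subgroupOf]
      refine ⟨?_, ((z.out : Q)⁻¹ * z'.out).2⟩
      simp only [Subgroup.coe_mul, Subgroup.coe_inv]
      refine MulAction.mem_stabilizer_iff.2 ?_
      rw [mul_smul, inv_smul_eq_iff]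
      exact h.symm
    · obtain ⟨q, hq, rfl⟩ := (hO y).1 hy
      refine ⟨QuotientGroup.mk ⟨q, hq⟩, Finset.mem_univ _, ?_⟩
      obtain ⟨s, hs⟩ := QuotientGroup.mk_out_eq_mul (S.subgroupOf Q) (⟨q, hq⟩ : Q)
      have hsx : ((s : Q) : G) • x = x := (Subgroup.mem_subgroupOf.1 s.2).1
      rw [hs, Subgroup.coe_mul, mul_smul, hsx]
  rw [key]
  exact (le_iSup₂_of_le (f := fun (S : Subgroup G) (_ : S < Q) => traceImage ρ S Q) S hSQ le_rfl)
    ⟨w x, hwS, rfl⟩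

lemma sum_mem_properTraces {Q : Subgroup G} {w : X → V}
    (hw : ∀ q ∈ Q, ∀ x, ρ q (w x) = w (q • x)) (s : Finset X)
    (hs : ∀ q ∈ Q, ∀ x ∈ s, q • x ∈ s) (hne : ∀ x ∈ s, ∃ q ∈ Q, q • x ≠ x) :
    ∑ x ∈ s, w x ∈ properTraces ρ Q := by
  classical
  induction s using Finset.strongInduction with
  | H s ih =>
    rcases s.eq_empty_or_nonempty with rfl | ⟨x, hx⟩
    · simp
    let O := s.filter fun y => ∃ q ∈ Q, q • x = y
    have hO : ∀ y, y ∈ O ↔ ∃ q ∈ Q, q • x = y := fun y => by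
      simp only [O, Finset.mem_filter, and_iff_right_iff_imp]
      rintro ⟨q, hq, rfl⟩
      exact hs q hq x hx
    have hxO : x ∈ O := (hO x).2 ⟨1, Q.one_mem, one_smul _ _⟩
    rw [← Finset.sum_sdiff (Finset.filter_subset _ s : O ⊆ s)]
    refine Submodule.add_mem _ (ih _ ?_ ?_ fun y hy => hne y (Finset.mem_sdiff.1 hy).1)
      (sum_orbit_mem_properTraces hw (hne x hx) hO)
    · exact Finset.sdiff_ssubset (Finset.filter_subset _ s) ⟨x, hxO⟩
    · intro q hq y hy
      rw [Finset.mem_sdiff] at hy ⊢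
      refine ⟨hs q hq y hy.1, fun h => hy.2 ?_⟩
      obtain ⟨r, hr, hry⟩ := (hO _).1 h
      exact (hO y).2 ⟨q⁻¹ * r, Q.mul_mem (Q.inv_mem hq) hr, by rw [mul_smul, hry, inv_smul_smul]⟩

end Traces

/-! ### Transitive `G`-sets -/

section Transitive

variable {k G V X : Type*} [Field k] [Group G] [AddCommGroup V] [Module k V]
  {ρ : Representation k G V} [MulAction G X]

/-- Frobenius reciprocity: a vector fixed by the stabilizer of `x₀` determines a homomorphism from
the permutation module on `X` to `V`. -/
lemma exists_equivariant [MulAction.IsPretransitive G X] {x₀ : X} {a : V}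
    (ha : a ∈ fixedPoints ρ (MulAction.stabilizer G x₀)) :
    ∃ u : X → V, (∀ g x, ρ g (u x) = u (g • x)) ∧ ∀ g : G, u (g • x₀) = ρ g a := by
  choose t ht using fun x : X => MulAction.exists_smul_eq G x₀ x
  have hu : ∀ g : G, ρ (t (g • x₀)) a = ρ g a := fun g => by
    have hs : g⁻¹ * t (g • x₀) ∈ MulAction.stabilizer G x₀ := by
      rw [MulAction.mem_stabilizer_iff, mul_smul, ht, inv_smul_smul]
    conv_rhs => rw [← mem_fixedPoints.1 ha _ hs]
    rw [← Module.End.mul_apply, ← map_mul, mul_inv_cancel_left]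
  refine ⟨fun x => ρ (t x) a, fun g x => ?_, hu⟩
  have : g • x = (g * t x) • x₀ := by rw [mul_smul, ht]
  simp only
  rw [this, hu, map_mul, Module.End.mul_apply]

lemma mem_normalizer_of_stabilizer_le [Finite G] [MulAction.IsPretransitive G X] {x₀ : X} {g : G}
    (hg : ∀ q ∈ MulAction.stabilizer G x₀, q • g • x₀ = g • x₀) :
    g ∈ Subgroup.normalizer (MulAction.stabilizer G x₀ : Set G) := by
  have hle : MulAction.stabilizer G x₀ ≤
      (MulAction.stabilizer G x₀).map (MulAut.conj g).toMonoidHom := by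
    rw [← MulAction.stabilizer_smul_eq_stabilizer_map_conj]
    exact fun q hq => hg q hq
  have heq : MulAction.stabilizer G x₀ =
      (MulAction.stabilizer G x₀).map (MulAut.conj g).toMonoidHom :=
    Subgroup.eq_of_le_of_card_ge hle (Subgroup.card_map_of_injective (MulAut.conj g).injective).le
  rw [Subgroup.mem_normalizer_iff]
  intro h
  conv_rhs => rw [heq]
  rw [Subgroup.mem_map_equiv]
  simp [mul_assoc]

end Transitive

/-! ### Direct summands of permutation modules -/

/-- A presentation of `ρ` as a direct summand of the permutation module on `X`: the vectors
`vec x` are the images of the basis vectors, the functionals `coord x` the coordinates. -/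
structure PermFrame {k G V : Type*} [Field k] [Group G] [AddCommGroup V] [Module k V]
    (ρ : Representation k G V) (X : Type*) [MulAction G X] [Fintype X] where
  vec : X → V
  coord : X → V →ₗ[k] k
  apply_vec : ∀ g x, ρ g (vec x) = vec (g • x)
  coord_apply : ∀ g x v, coord (g • x) (ρ g v) = coord x v
  sum_eq : ∀ v, ∑ x, coord x v • vec x = v

/-- Summing over both variables only gives the equality multiplied by `|X|`, which may vanish in
`k`. The proof therefore counts the values of `κ` with multiplicity in `k →₀ ℕ`, where `|X|` can be
cancelled. -/
lemma sum_kernel_comm {k G X : Type*} [Field k] [Group G] [MulAction G X]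
    [MulAction.IsPretransitive G X] [Fintype X] (κ : X → X → k)
    (hκ : ∀ (g : G) x y, κ (g • x) (g • y) = κ x y) (x₀ : X) :
    ∑ y, κ y x₀ = ∑ y, κ x₀ y := by
  classical
  let A : X → k →₀ ℕ := fun x => ∑ y, Finsupp.single (κ y x) 1
  let B : X → k →₀ ℕ := fun x => ∑ y, Finsupp.single (κ x y) 1
  have hA : ∀ x, A x = A x₀ := fun x => by
    obtain ⟨g, rfl⟩ := MulAction.exists_smul_eq G x₀ x
    refine (Fintype.sum_equiv (MulAction.toPerm g) _ _ fun y => ?_).symm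
    rw [MulAction.toPerm_apply, hκ]
  have hB : ∀ x, B x = B x₀ := fun x => by
    obtain ⟨g, rfl⟩ := MulAction.exists_smul_eq G x₀ x
    refine (Fintype.sum_equiv (MulAction.toPerm g) _ _ fun y => ?_).symm
    rw [MulAction.toPerm_apply, hκ]
  have hAB : ∑ x, A x = ∑ x, B x := Finset.sum_comm
  rw [Finset.sum_congr rfl fun x _ => hA x, Finset.sum_congr rfl fun x _ => hB x,
    Finset.sum_const, Finset.sum_const] at hAB
  have : Nonempty X := ⟨x₀⟩
  have hAB' : A x₀ = B x₀ := by
    ext c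
    have := DFunLike.congr_fun hAB c
    simpa using this
  -- Row and column have the same multiset of values; this map adds the values up in `k`.
  have := congrArg (Finsupp.liftAddHom fun c : k => (AddMonoidHom.mk' (fun n : ℕ => (n : k) * c)
    (fun a b => by push_cast; ring))) hAB'
  simpa [A, B, map_sum] using this

namespace PermFrame

variable {k G V X : Type*} [Field k] [Group G] [AddCommGroup V] [Module k V]
  {ρ : Representation k G V} [MulAction G X] [Fintype X] (F : PermFrame ρ X)

/-- The restriction of the augmentation map. -/
noncomputable def aug : V →ₗ[k] k := ∑ x, F.coord x

lemma aug_apply (v : V) : F.aug v = ∑ x, F.coord x v := by simp [aug]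

lemma aug_rep (g : G) (v : V) : F.aug (ρ g v) = F.aug v := by
  rw [aug_apply, aug_apply]
  refine (Fintype.sum_equiv (MulAction.toPerm g) _ _ fun y => ?_).symm
  rw [MulAction.toPerm_apply, coord_apply]

lemma coord_smul_of_mem_fixedPoints {Q : Subgroup G} {v : V} (hv : v ∈ fixedPoints ρ Q) {q : G}
    (hq : q ∈ Q) (x : X) : F.coord (q • x) v = F.coord x v := by
  conv_lhs => rw [← mem_fixedPoints.1 hv q hq]
  exact F.coord_apply q x v

/-- By transitivity all coordinates of `v₀` equal some `c ≠ 0`, so `v₀ = c ∑ vec y`. Applying `coord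
x` gives `∑ y, coord x (vec y) = 1`, and `sum_kernel_comm` transposes this sum into the
augmentation. -/
lemma aug_vec [MulAction.IsPretransitive G X] {v₀ : V} (h0 : v₀ ≠ 0)
    (hv₀ : ∀ g : G, ρ g v₀ = v₀) (x : X) : F.aug (F.vec x) = 1 := by
  have hc : ∀ y, F.coord y v₀ = F.coord x v₀ := fun y => by
    obtain ⟨g, rfl⟩ := MulAction.exists_smul_eq G x y
    conv_lhs => rw [← hv₀ g]
    exact F.coord_apply g x v₀
  have h1 := F.sum_eq v₀
  rw [Finset.sum_congr rfl fun y _ => by rw [hc y]] at h1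
  have hc0 : F.coord x v₀ ≠ 0 := fun h => h0 (by rw [← h1]; simp [h])
  have h2 := congrArg (F.coord x) h1
  rw [map_sum] at h2
  simp only [map_smul, smul_eq_mul] at h2
  rw [← Finset.mul_sum, mul_eq_left₀ hc0] at h2
  rw [aug_apply, ← h2]
  refine sum_kernel_comm (G := G) (fun y x => F.coord y (F.vec x)) (fun g x y => ?_) x
  rw [← F.apply_vec, F.coord_apply]

lemma finiteDimensional (F : PermFrame ρ X) : FiniteDimensional k V := by
  refine Module.Finite.of_surjective (Fintype.linearCombination k F.vec) fun v => ?_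
  exact ⟨fun x => F.coord x v, by rw [Fintype.linearCombination_apply, F.sum_eq]⟩

lemma vec_mem_fixedPoints {Q : Subgroup G} {x : X} (hx : ∀ q ∈ Q, q • x = x) :
    F.vec x ∈ fixedPoints ρ Q := mem_fixedPoints.2 fun q hq => by rw [F.apply_vec, hx q hq]

lemma apply_eq_of_forall_smul_eq (F : PermFrame ρ X) {g : G} (hg : ∀ x : X, g • x = x) (v : V) : ρ g v = v := by
  conv_lhs => rw [← F.sum_eq v]
  rw [map_sum]
  simp only [map_smul, F.apply_vec, hg, F.sum_eq]

section Finite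

variable [Finite G]

-- The coordinates of a `Q`-fixed vector are constant on `Q`-orbits, so the sum splits into
-- nontrivial orbit sums. A general `u` is allowed in order to cover homomorphisms out of the
-- permutation module as well as the frame itself.
open scoped Classical in
lemma sum_nonfixed_mem_properTraces {u : X → V} (hu : ∀ g x, ρ g (u x) = u (g • x))
    {Q : Subgroup G} {v : V} (hv : v ∈ fixedPoints ρ Q) :
    ∑ x with ¬ ∀ q ∈ Q, q • x = x, F.coord x v • u x ∈ properTraces ρ Q := by
  refine sum_mem_properTraces (fun q hq x => ?_) _ (fun q hq x hx => ?_) fun x hx => ?_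
  · rw [map_smul, hu, F.coord_smul_of_mem_fixedPoints hv hq]
  · rw [Finset.mem_filter] at hx ⊢
    refine ⟨Finset.mem_univ _, fun h => hx.2 fun r hr => ?_⟩
    have := h (q * r * q⁻¹) (Q.mul_mem (Q.mul_mem hq hr) (Q.inv_mem hq))
    rw [mul_smul, inv_smul_smul, mul_smul] at this
    exact smul_left_cancel q this
  · simpa using hx

/-- A coordinate at a `Q`-fixed point is a `Q`-invariant functional, so it kills proper traces;
conversely the moved points contribute only proper traces. Hence the traces depend on `Q` only
through its fixed vectors and fixed points. -/
lemma mem_properTraces_iff {p : ℕ} [Fact p.Prime] [CharP k p] {Q : Subgroup G}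
    (hQ : IsPGroup p Q) {v : V} : v ∈ properTraces ρ Q ↔
      v ∈ fixedPoints ρ Q ∧ ∀ x : X, (∀ q ∈ Q, q • x = x) → F.coord x v = 0 := by
  classical
  refine ⟨fun h => ⟨properTraces_le_fixedPoints Q h, fun x hx =>
    eq_zero_of_mem_properTraces hQ (fun q hq v => ?_) h⟩, fun ⟨hv, h⟩ => ?_⟩
  · conv_lhs => rw [← hx q hq]
    exact F.coord_apply q x v
  · rw [← F.sum_eq v, ← Finset.sum_filter_add_sum_filter_not Finset.univ
      (fun x => ∀ q ∈ Q, q • x = x), Finset.sum_eq_zero, zero_add]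
    · exact F.sum_nonfixed_mem_properTraces F.apply_vec hv
    · intro x hx
      rw [h x (Finset.mem_filter.1 hx).2, zero_smul]

lemma subsingleton_brauerQuotient (F : PermFrame ρ X) {p : ℕ} [Fact p.Prime] [CharP k p] {Q : Subgroup G}
    (hQ : IsPGroup p Q) (hX : ∀ x : X, ¬ ∀ q ∈ Q, q • x = x) :
    Subsingleton (BrauerQuotient ρ Q) :=
  BrauerScott.subsingleton_brauerQuotient fun _ hv =>
    (F.mem_properTraces_iff hQ).2 ⟨hv, fun x hx => absurd hx (hX x)⟩

/-- In an indecomposable direct summand of a transitive permutation module, the Brauer quotient at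
the point stabilizer is generated by each element with nonzero augmentation. -/
lemma eq_fixedPoints_of_aug_ne_zero (F : PermFrame ρ X) [MulAction.IsPretransitive G X]
    (hV : SectionIndecomposable ρ ⊤ ⊥ ⊤) {x₀ : X} (hx₀ : F.aug (F.vec x₀) ≠ 0)
    {A : Submodule k V}
    (hA : IsStable ρ (Subgroup.normalizer (MulAction.stabilizer G x₀ : Set G)) A)
    (hZA : properTraces ρ (MulAction.stabilizer G x₀) ≤ A)
    (hAF : A ≤ fixedPoints ρ (MulAction.stabilizer G x₀)) (ha : ∃ a ∈ A, F.aug a ≠ 0) :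
    A = fixedPoints ρ (MulAction.stabilizer G x₀) := by
  classical
  have := F.finiteDimensional
  obtain ⟨a, haA, ha⟩ := ha
  obtain ⟨u, hu, hua⟩ := exists_equivariant (hAF haA)
  -- The endomorphism of `M` induced by `a`. It multiplies `ε` by `ε a ≠ 0`, hence is not nilpotent
  -- and is bijective by Fitting.
  let φ : V →ₗ[k] V := ∑ x, (F.coord x).smulRight (u x)
  have hφ : ∀ v, φ v = ∑ x, F.coord x v • u x := fun v => by simp [φ]
  have hφρ : ∀ g v, φ (ρ g v) = ρ g (φ v) := by
    intro g v
    rw [hφ, hφ, map_sum]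
    refine (Fintype.sum_equiv (MulAction.toPerm g) _ _ fun x => ?_).symm
    rw [MulAction.toPerm_apply, F.coord_apply, map_smul, hu]
  have hεu : ∀ x, F.aug (u x) = F.aug a := fun x => by
    obtain ⟨g, rfl⟩ := MulAction.exists_smul_eq G x₀ x
    rw [hua, aug_rep]
  have hεφ : ∀ v, F.aug (φ v) = F.aug a * F.aug v := fun v => by
    rw [hφ, map_sum]
    simp only [map_smul, hεu, smul_eq_mul]
    rw [← Finset.sum_mul, ← F.aug_apply, mul_comm]
  have hpow : ∀ n : ℕ, F.aug ((φ ^ n) (F.vec x₀)) ≠ 0 := by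
    intro n
    induction n with
    | zero => simpa using hx₀
    | succ n ih =>
      rw [pow_succ', Module.End.mul_apply, hεφ]
      exact mul_ne_zero ha ih
  have hbij : Function.Bijective φ := bijective_of_commute hV (fun h _ v => hφρ h v)
    (v := F.vec x₀) fun n h => hpow n (by rw [h, map_zero])
  have hfix : ∀ g : G, (∀ q ∈ MulAction.stabilizer G x₀, q • g • x₀ = g • x₀) →
      ∀ b ∈ A, ρ g b ∈ A := fun g hg b hb => hA g (mem_normalizer_of_stabilizer_le hg) b hb
  have hx₀A : F.vec x₀ ∈ A := by
    obtain ⟨v, hv⟩ := hbij.2 (F.vec x₀)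
    have hvfix : v ∈ fixedPoints ρ (MulAction.stabilizer G x₀) := mem_fixedPoints.2 fun q hq => by
      apply hbij.1
      rw [hφρ, hv, F.apply_vec, MulAction.mem_stabilizer_iff.1 hq]
    -- Points fixed by the stabilizer are translates of `x₀` under its normalizer, so they
    -- contribute elements of `A`; the other points contribute proper traces.
    rw [← hv, hφ, ← Finset.sum_filter_add_sum_filter_not Finset.univ
      (fun x => ∀ q ∈ MulAction.stabilizer G x₀, q • x = x)]
    refine A.add_mem (A.sum_mem fun x hx => ?_) (hZA (F.sum_nonfixed_mem_properTraces hu hvfix))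
    obtain ⟨g, rfl⟩ := MulAction.exists_smul_eq G x₀ x
    rw [hua]
    exact A.smul_mem _ (hfix g (Finset.mem_filter.1 hx).2 a haA)
  refine le_antisymm hAF fun v hv => ?_
  rw [← F.sum_eq v, ← Finset.sum_filter_add_sum_filter_not Finset.univ
      (fun x => ∀ q ∈ MulAction.stabilizer G x₀, q • x = x)]
  refine A.add_mem (A.sum_mem fun x hx => ?_)
    (hZA (F.sum_nonfixed_mem_properTraces F.apply_vec hv))
  obtain ⟨g, rfl⟩ := MulAction.exists_smul_eq G x₀ x
  rw [← F.apply_vec]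
  exact A.smul_mem _ (hfix g (Finset.mem_filter.1 hx).2 _ hx₀A)

/-- If `M` is indecomposable over `C_G(T)` for a `p`-subgroup `T` of the point stabilizer `P`, then
`T` acts trivially on `M`. -/
lemma apply_eq_self_of_isIndecomposable (F : PermFrame ρ X) {p : ℕ} [Fact p.Prime] [CharP k p] {T : Subgroup G}
    (hT : IsPGroup p T)
    (hV : SectionIndecomposable ρ (Subgroup.centralizer (T : Set G)) ⊥ ⊤)
    {x₀ : X} (hTx₀ : ∀ t ∈ T, t • x₀ = x₀) (hx₀ : F.aug (F.vec x₀) ≠ 0) {t : G} (ht : t ∈ T)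
    (v : V) : ρ t v = v := by
  classical
  have := F.finiteDimensional
  let Y : Finset X := Finset.univ.filter fun x => ∀ q ∈ T, q • x = x
  have hY : ∀ x, x ∈ Y ↔ ∀ q ∈ T, q • x = x := fun x => by simp [Y]
  -- The truncation to the `T`-fixed points commutes with `C_G(T)` and has image in `M ^ T`. On `M ^
  -- T` it changes vectors only by proper traces, so it preserves `ε` there and is not nilpotent; by
  -- Fitting it is onto, whence `M = M ^ T`.
  let θ : V →ₗ[k] V := ∑ x ∈ Y, (F.coord x).smulRight (F.vec x)
  have hθ : ∀ v, θ v = ∑ x ∈ Y, F.coord x v • F.vec x := fun v => by simp [θ]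
  have hTθ : ∀ t ∈ T, ∀ v, ρ t (θ v) = θ v := by
    intro t ht v
    rw [hθ, map_sum]
    refine Finset.sum_congr rfl fun x hx => ?_
    rw [map_smul, F.apply_vec, (hY x).1 hx t ht]
  have hθρ : ∀ c ∈ Subgroup.centralizer (T : Set G), ∀ v, θ (ρ c v) = ρ c (θ v) := by
    intro c hc v
    have hsm : ∀ x, c • x ∈ Y ↔ x ∈ Y := fun x => by
      rw [hY, hY]
      refine forall₂_congr fun q hq => ?_
      rw [← mul_smul, Subgroup.mem_centralizer_iff.1 hc q hq, mul_smul, smul_left_cancel_iff]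
    rw [hθ, hθ, map_sum]
    refine (Finset.sum_equiv (MulAction.toPerm c) (fun x => (hsm x).symm) fun x _ => ?_).symm
    rw [MulAction.toPerm_apply, F.coord_apply, map_smul, F.apply_vec]
  have hεθ : ∀ v ∈ fixedPoints ρ T, F.aug (θ v) = F.aug v := by
    intro v hv
    have h1 := F.sum_eq v
    rw [← Finset.sum_filter_add_sum_filter_not Finset.univ (fun x => ∀ q ∈ T, q • x = x)] at h1
    have h2 := eq_zero_of_mem_properTraces hT (f := F.aug) (fun q _ v => F.aug_rep q v)
      (F.sum_nonfixed_mem_properTraces F.apply_vec hv)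
    conv_rhs => rw [← h1]
    rw [map_add, h2, add_zero, hθ]
  have hpow : ∀ n : ℕ, (θ ^ n) (F.vec x₀) ∈ fixedPoints ρ T ∧
      F.aug ((θ ^ n) (F.vec x₀)) ≠ 0 := by
    intro n
    induction n with
    | zero => exact ⟨F.vec_mem_fixedPoints hTx₀, hx₀⟩
    | succ n ih =>
      rw [pow_succ', Module.End.mul_apply]
      exact ⟨mem_fixedPoints.2 fun t ht => hTθ t ht _, by rw [hεθ _ ih.1]; exact ih.2⟩
  have hbij : Function.Bijective θ := bijective_of_commute hV hθρ
    (v := F.vec x₀) fun n h => (hpow n).2 (by rw [h, map_zero])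
  obtain ⟨w, rfl⟩ := hbij.2 v
  exact hTθ t ht w

end Finite

end PermFrame

end BrauerScott

namespace BrauerScott

/-! ### The induced module as a permutation module -/

section Induced

variable {k G V : Type*} [Field k] [Group G] [AddCommGroup V] [Module k V]

/-- The coordinates of a vector of the module induced from the trivial `kP`-module with respect to
the basis `G ⧸ P`. -/
noncomputable def indCoord (k : Type*) [Field k] {G : Type*} [Group G]
    (P : Subgroup G) [DecidableEq (G ⧸ P)] :
    Representation.IndV P.subtype (Representation.trivial k P k) →ₗ[k] (G ⧸ P → k) :=
  Representation.Coinvariants.lift _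
    ((Finsupp.linearCombination k fun h : G => (Pi.single (QuotientGroup.mk h⁻¹ : G ⧸ P) (1 : k) :
      G ⧸ P → k)) ∘ₗ (MonoidAlgebra.coeffLinearEquiv k).toLinearMap ∘ₗ
        (TensorProduct.rid k _).toLinearMap) fun g => by
    have h : ∀ x : G, (QuotientGroup.mk (x⁻¹ * (g : G)⁻¹) : G ⧸ P) = QuotientGroup.mk x⁻¹ :=
      fun x => QuotientGroup.mk_mul_of_mem _ (P.inv_mem g.2)
    ext x
    simp [h]

lemma indCoord_mk (P : Subgroup G) [DecidableEq (G ⧸ P)] (h : G) :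
    indCoord k P (Representation.IndV.mk P.subtype (Representation.trivial k P k) h 1) =
      Pi.single (QuotientGroup.mk h⁻¹ : G ⧸ P) 1 := by
  simp [indCoord]

/-- The generator at `h` depends only on the coset `P h`, equivalently on `h⁻¹ P`; hence the
inverses in the indexing by `G ⧸ P`. -/
lemma indV_mk_mul (P : Subgroup G) (p : P) (h : G) :
    Representation.IndV.mk P.subtype (Representation.trivial k P k) (p * h) 1 =
      Representation.IndV.mk P.subtype (Representation.trivial k P k) h 1 := by
  have := Representation.Coinvariants.mk_self_apply (Representation.tprod
    ((Representation.leftRegular k G).comp P.subtype) (Representation.trivial k P k)) p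
    (TensorProduct.mk k _ _ (MonoidAlgebra.single h 1) 1)
  simpa using this

lemma exists_permFrame {ρ : Representation k G V} {P : Subgroup G} [Fintype (G ⧸ P)]
    (h : IsDirectSummand ρ (Representation.ind P.subtype (Representation.trivial k P k))) :
    Nonempty (PermFrame ρ (G ⧸ P)) := by
  classical
  obtain ⟨i, r, hri⟩ := h
  let b : G ⧸ P → Representation.IndV P.subtype (Representation.trivial k P k) :=
    fun x => Representation.IndV.mk _ _ (x.out)⁻¹ 1
  have hb : ∀ h : G, b (QuotientGroup.mk h) = Representation.IndV.mk _ _ h⁻¹ 1 := fun h => by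
    obtain ⟨p, hp⟩ := QuotientGroup.mk_out_eq_mul P h
    simp only [b]
    rw [hp, mul_inv_rev]
    exact indV_mk_mul P p⁻¹ h⁻¹
  have hgb : ∀ g x, Representation.ind P.subtype (Representation.trivial k P k) g (b x) =
      b (g • x) := by
    intro g x
    induction x using QuotientGroup.induction_on with
    | H y =>
      rw [MulAction.Quotient.smul_mk, hb, hb, Representation.ind_mk, smul_eq_mul, mul_inv_rev]
  have hsum : ∀ w, ∑ x, indCoord k P w x • b x = w := by
    intro w
    have : (Fintype.linearCombination k b) ∘ₗ indCoord k P = LinearMap.id := by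
      refine Representation.IndV.hom_ext _ _ fun h => LinearMap.ext_ring ?_
      rw [LinearMap.comp_apply, LinearMap.comp_apply, indCoord_mk,
        Fintype.linearCombination_apply_single, one_smul, hb, inv_inv]
      rfl
    simpa [Fintype.linearCombination_apply] using LinearMap.congr_fun this w
  have hcoord : ∀ g x w, indCoord k P
      (Representation.ind P.subtype (Representation.trivial k P k) g w) (g • x) =
      indCoord k P w x := by
    intro g x w
    rw [← hsum w]
    simp only [map_sum, map_smul, hgb, Finset.sum_apply, Pi.smul_apply]
    refine Finset.sum_congr rfl fun y _ => ?_
    congr 1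
    induction y using QuotientGroup.induction_on with
    | H y =>
      rw [MulAction.Quotient.smul_mk, hb, hb, indCoord_mk, indCoord_mk, inv_inv, inv_inv,
        ← MulAction.Quotient.smul_mk, Pi.single_apply, Pi.single_apply]
      simp only [smul_left_cancel_iff]
  refine ⟨⟨fun x => r (b x), fun x => LinearMap.proj x ∘ₗ indCoord k P ∘ₗ i.toLinearMap,
    fun g x => ?_, fun g x v => ?_, fun v => ?_⟩⟩
  · rw [← r.isIntertwining, hgb]
  · change indCoord k P (i (ρ g v)) (g • x) = indCoord k P (i v) x
    rw [i.isIntertwining, hcoord]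
  · change ∑ x, indCoord k P (i v) x • r (b x) = v
    conv_rhs => rw [← hri v, ← hsum (i v)]
    rw [map_sum]
    simp only [map_smul]

end Induced

/-! ### The index of `P C_G(P)` in `N_G(P)` -/

section Index

variable {G : Type*} [Group G]

lemma map_conj_centralizer (g : G) (P : Subgroup G) :
    (Subgroup.centralizer (P : Set G)).map (MulAut.conj g).toMonoidHom =
      Subgroup.centralizer (P.map (MulAut.conj g).toMonoidHom : Set G) := by
  ext x
  rw [Subgroup.mem_map_equiv, MulAut.conj_symm_apply, Subgroup.mem_centralizer_iff,
    Subgroup.mem_centralizer_iff]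
  constructor
  · rintro h _ ⟨y, hy, rfl⟩
    have := congrArg (fun z => g * z * g⁻¹) (h y hy)
    simpa [mul_assoc] using this
  · intro h y hy
    have := congrArg (fun z => g⁻¹ * z * g) (h _ ⟨y, hy, rfl⟩)
    simpa [mul_assoc] using this

lemma relIndex_map_conj (g : G) (P : Subgroup G) :
    (P.map (MulAut.conj g).toMonoidHom ⊔
      Subgroup.centralizer (P.map (MulAut.conj g).toMonoidHom : Set G)).relIndex
        (Subgroup.normalizer (P.map (MulAut.conj g).toMonoidHom : Set G)) =
    (P ⊔ Subgroup.centralizer (P : Set G)).relIndex (Subgroup.normalizer (P : Set G)) := by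
  have h := Subgroup.map_equiv_normalizer_eq P (MulAut.conj g)
  rw [← map_conj_centralizer, ← Subgroup.map_sup, ← h,
    Subgroup.relIndex_map_map_of_injective _ _ (MulAut.conj g).injective]

/-- The only subgroup of `P` isomorphic to `P` is `P` itself, so saturation makes `P` fully
automized. Pulling the Sylow condition back along `N_G(P) → Aut(P)`, whose kernel is `C_G(P)`, turns
`Aut_P(P)` into `P C_G(P)`. -/
lemma not_dvd_relIndex_of_isSaturated [Finite G] {p : ℕ} [Fact p.Prime] {P : Subgroup G}
    (h : IsSaturated p P) :
    ¬ p ∣ (P ⊔ Subgroup.centralizer (P : Set G)).relIndex (Subgroup.normalizer (P : Set G)) := by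
  obtain ⟨Q, hQP, ⟨φ, -⟩, ⟨S, hS⟩, -⟩ := h P le_rfl
  obtain rfl : Q = P := Subgroup.eq_of_le_of_card_ge hQP (Nat.card_congr φ.toEquiv).le
  have h1 : ¬ p ∣ (autOf Q Q).relIndex (autOf ⊤ Q) := by
    have := S.not_dvd_index
    rwa [hS] at this
  have h2 : autOf ⊤ Q = Q.normalizerMonoidHom.range := by
    rw [autOf, Subgroup.top_subgroupOf, MonoidHom.range_eq_map]
  rw [h2, ← Subgroup.index_comap, autOf, Subgroup.comap_map_eq, Subgroup.normalizerMonoidHom_ker,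
    ← Subgroup.subgroupOf_sup Subgroup.le_normalizer
      (Subgroup.centralizer_le_normalizer _)] at h1
  exact h1

end Index

/-! ### Trivially acting subgroups, conjugation, and the section at the point stabilizer -/

section Main

variable {k G V : Type*} [Field k] [Group G] [AddCommGroup V] [Module k V]
  {ρ : Representation k G V}

/-- The subgroup of the elements of `G` that fix the vector `v`. -/
def vecStabilizer (ρ : Representation k G V) (v : V) : Subgroup G where
  carrier := {g | ρ g v = v}
  one_mem' := by simp
  mul_mem' {a b} ha hb := by
    rw [Set.mem_ofPred_eq] at ha hb ⊢
    rw [map_mul, Module.End.mul_apply, hb, ha]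
  inv_mem' {a} ha := by
    rw [Set.mem_ofPred_eq] at ha ⊢
    conv_lhs => rw [← ha, apply_inv_apply]

lemma mem_fixedPoints_iff_le_vecStabilizer {Q : Subgroup G} {v : V} :
    v ∈ fixedPoints ρ Q ↔ Q ≤ vecStabilizer ρ v := mem_fixedPoints

lemma fixedPoints_sup_of_le_ker {Q R : Subgroup G} (hR : R ≤ ρ.ker) :
    fixedPoints ρ (Q ⊔ R) = fixedPoints ρ Q := by
  ext v
  rw [mem_fixedPoints_iff_le_vecStabilizer, mem_fixedPoints_iff_le_vecStabilizer, sup_le_iff,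
    and_iff_left]
  intro r hr
  have : ρ r = 1 := hR hr
  change ρ r v = v
  rw [this, Module.End.one_apply]

lemma IsStable.sup_subgroup {H K : Subgroup G} {A : Submodule k V} (hH : IsStable ρ H A)
    (hK : IsStable ρ K A) : IsStable ρ (H ⊔ K) A := by
  intro g hg
  suffices (∀ a ∈ A, ρ g a ∈ A) ∧ ∀ a ∈ A, ρ g⁻¹ a ∈ A from this.1
  rw [Subgroup.sup_eq_closure] at hg
  induction hg using Subgroup.closure_induction with
  | mem x hx =>
    rcases hx with hx | hx
    · exact ⟨hH x hx, hH _ (H.inv_mem hx)⟩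
    · exact ⟨hK x hx, hK _ (K.inv_mem hx)⟩
  | one => simp
  | mul x y _ _ hx hy =>
    simp only [mul_inv_rev, map_mul, Module.End.mul_apply]
    exact ⟨fun a ha => hx.1 _ (hy.1 a ha), fun a ha => hy.2 _ (hx.2 a ha)⟩
  | inv x _ hx => exact ⟨hx.2, by simpa using hx.1⟩

/-- `H` fixes `F` pointwise, so stability under `H` costs nothing for subspaces of `F`. -/
lemma SectionIndecomposable.of_sup {H K : Subgroup G} {Z F : Submodule k V}
    (h : SectionIndecomposable ρ (H ⊔ K) Z F) (hF : F ≤ fixedPoints ρ H) :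
    SectionIndecomposable ρ K Z F := by
  have key : ∀ A ≤ F, IsStable ρ H A := fun A hA g hg a ha => by
    rwa [mem_fixedPoints.1 (hF (hA ha)) g hg]
  intro A B hA hB hZA hZB hAB
  exact h A B ((key A (hAB ▸ le_sup_left)).sup_subgroup hA)
    ((key B (hAB ▸ le_sup_right)).sup_subgroup hB) hZA hZB hAB

lemma SectionIndecomposable.map_conj {H : Subgroup G} (h : SectionIndecomposable ρ H ⊥ ⊤) (g : G) :
    SectionIndecomposable ρ (H.map (MulAut.conj g).toMonoidHom) ⊥ ⊤ := by
  let e : V ≃ₗ[k] V := LinearEquiv.ofLinearMap (ρ g) (ρ g⁻¹)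
    (by ext v; simp) (by ext v; simp)
  have hst : ∀ A, IsStable ρ (H.map (MulAut.conj g).toMonoidHom) A →
      IsStable ρ H (Submodule.orderIsoMapComap e.symm A) := by
    rintro A hA x hx _ ⟨a, ha, rfl⟩
    refine ⟨ρ (g * x * g⁻¹) a, hA _ ⟨x, hx, rfl⟩ a ha, ?_⟩
    change ρ g⁻¹ (ρ (g * x * g⁻¹) a) = ρ x (ρ g⁻¹ a)
    rw [← Module.End.mul_apply, ← Module.End.mul_apply, ← map_mul, ← map_mul]
    congr 2
    group
  intro A B hA hB _ _ hAB hAB'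
  refine (h _ _ (hst A hA) (hst B hB) bot_le bot_le ?_ ?_).imp ?_ ?_
  · rw [← map_sup, hAB, map_top]
  · rw [← map_inf, hAB', map_bot]
  · rw [map_eq_bot_iff]; exact id
  · rw [map_eq_bot_iff]; exact id

/-- Every functional is `Q`-invariant here, hence kills the traces, and functionals separate points.
-/
lemma properTraces_eq_bot [Finite G] {p : ℕ} [Fact p.Prime] [CharP k p] {Q : Subgroup G}
    (hQ : IsPGroup p Q) (h : ∀ q ∈ Q, ∀ v, ρ q v = v) : properTraces ρ Q = ⊥ := by
  rw [eq_bot_iff]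
  intro v hv
  rw [Submodule.mem_bot, ← Module.forall_dual_apply_eq_zero_iff k]
  exact fun f => eq_zero_of_mem_properTraces hQ (f := f) (fun q hq v => by rw [h q hq]) hv

/-- The Brauer quotient at the point stabilizer is indecomposable over its centralizer. -/
lemma PermFrame.sectionIndecomposable_stabilizer {X : Type*} [MulAction G X] [Fintype X]
    [MulAction.IsPretransitive G X] [Finite G] {p : ℕ} [Fact p.Prime] [CharP k p]
    (F : PermFrame ρ X) (hV : SectionIndecomposable ρ ⊤ ⊥ ⊤) {x₀ : X} (hx₀ : F.aug (F.vec x₀) ≠ 0)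
    (hp : IsPGroup p (MulAction.stabilizer G x₀))
    (hidx : ¬ p ∣ (MulAction.stabilizer G x₀ ⊔
      Subgroup.centralizer (MulAction.stabilizer G x₀ : Set G)).relIndex
        (Subgroup.normalizer (MulAction.stabilizer G x₀ : Set G))) :
    SectionIndecomposable ρ (Subgroup.centralizer (MulAction.stabilizer G x₀ : Set G))
      (properTraces ρ (MulAction.stabilizer G x₀))
      (fixedPoints ρ (MulAction.stabilizer G x₀)) := by
  have := F.finiteDimensional
  set P := MulAction.stabilizer G x₀ with hP
  refine SectionIndecomposable.of_sup (H := P) ?_ le_rfl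
  refine sectionIndecomposable_of_generated (ε := F.aug) (sup_centralizer_le_normalizer P) ?_ ?_
    (fun n _ v => F.aug_rep n v) (properTraces_le_fixedPoints P) (isStable_properTraces P)
    (isStable_fixedPoints P)
    (fun z hz => eq_zero_of_mem_properTraces hp (fun q _ v => F.aug_rep q v) hz)
    ⟨F.vec x₀, F.vec_mem_fixedPoints fun q hq => hq, hx₀⟩
    (fun A hA hZA hAF ha => F.eq_fixedPoints_of_aug_ne_zero hV hx₀ hA hZA hAF ha)
  · intro n hn h hh
    have hPn := map_conj_of_mem_normalizer hn
    have : (P ⊔ Subgroup.centralizer (P : Set G)).map (MulAut.conj n).toMonoidHom =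
        P ⊔ Subgroup.centralizer (P : Set G) := by
      rw [Subgroup.map_sup, map_conj_centralizer, hPn]
    rw [← this]
    exact ⟨h, hh, rfl⟩
  · rwa [Ne, CharP.cast_eq_zero_iff k p]

end Main

end BrauerScott

/-! ### The main theorem -/

open BrauerScott in
theorem theorem3 {p : ℕ} [Fact p.Prime] {k : Type*} [Field k] [IsAlgClosed k] [CharP k p]
    {G : Type*} [Group G] [Finite G] (P : Subgroup G) (hP : IsPGroup p P)
    (hsat : BrauerScott.IsSaturated p P)
    {V : Type*} [AddCommGroup V] [Module k V] (M : Representation k G V)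
    (hM : BrauerScott.IsScottModule P M) :
    (∀ R : Subgroup G, R.Normal → R ≤ P ⊓ M.ker →
      (∀ T : Subgroup G, T ⋖ P → R ≤ T →
        BrauerScott.IsIndecomposable
          (BrauerScott.resSubgroup M (Subgroup.centralizer (T : Set G)))) →
      BrauerScott.IsBrauerIndecomposable M p) ∧
    P.normalCore ≤ P ⊓ M.ker ∧
    (∀ R : Subgroup G, R.Normal → R ≤ P ⊓ M.ker → R ≤ P.normalCore) := by
  have := Fintype.ofFinite (G ⧸ P)
  obtain ⟨hind, hsum, v₀, hv₀, hfix⟩ := hM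
  obtain ⟨F⟩ := exists_permFrame hsum
  have haug : ∀ x, F.aug (F.vec x) ≠ 0 := fun x => by
    rw [F.aug_vec hv₀ hfix]; exact one_ne_zero
  have hV : SectionIndecomposable M ⊤ ⊥ ⊤ := by
    intro A B hA hB _ _ hAB hAB'
    let U : Subrepresentation M := ⟨A, fun g v hv => hA g trivial v hv⟩
    let W : Subrepresentation M := ⟨B, fun g v hv => hB g trivial v hv⟩
    exact (hind.2 U W ⟨disjoint_iff.2 (Subrepresentation.toSubmodule_injective hAB'),
      codisjoint_iff.2 (Subrepresentation.toSubmodule_injective hAB)⟩).imp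
      (fun e => congrArg Subrepresentation.toSubmodule e)
      (fun e => congrArg Subrepresentation.toSubmodule e)
  refine ⟨fun R hRn hR hT Q hQ => ?_, le_inf P.normalCore_le fun g hg => ?_,
    fun R hRn hR => (Subgroup.normal_le_normalCore (hN := hRn)).2 (hR.trans inf_le_left)⟩
  · by_cases hX : ∃ x : G ⧸ P, ∀ q ∈ Q, q • x = x
    swap
    · exact Or.inr (F.subsingleton_brauerQuotient hQ (not_exists.1 hX))
    obtain ⟨x₀, hx₀⟩ := hX
    obtain ⟨g, rfl⟩ := MulAction.exists_smul_eq G ((1 : G) : G ⧸ P) x₀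
    have hstab : MulAction.stabilizer G (g • ((1 : G) : G ⧸ P)) =
        P.map (MulAut.conj g).toMonoidHom := by
      rw [MulAction.stabilizer_smul_eq_stabilizer_map_conj, MulAction.stabilizer_quotient]
    have hvQ : F.vec (g • ((1 : G) : G ⧸ P)) ∈ fixedPoints M Q := F.vec_mem_fixedPoints hx₀
    have hvQ' : F.vec (g • ((1 : G) : G ⧸ P)) ∉ properTraces M Q := fun h =>
      haug _ (eq_zero_of_mem_properTraces hQ (fun q _ v => F.aug_rep q v) h)
    refine Or.inl (isIndecomposable_brauer (properTraces_le_fixedPoints Q) hvQ hvQ' ?_)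
    have hRconj : ∀ g : G, R.map (MulAut.conj g).toMonoidHom = R := fun g =>
      map_conj_of_mem_normalizer (Subgroup.normalizer_eq_top_iff.2 hRn ▸ Subgroup.mem_top g)
    set P' := MulAction.stabilizer G (g • ((1 : G) : G ⧸ P)) with hP'
    have hQP' : Q ≤ P' := hx₀
    have hRP' : R ≤ P' := by
      rw [hstab, ← hRconj g]
      exact Subgroup.map_mono (hR.trans inf_le_left)
    -- `P'` is the conjugate of `P` fixing the chosen point; everything depends on whether `QR`
    -- fills it.
    rcases (sup_le hQP' hRP').eq_or_lt with heq | hlt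
    · have hPp : IsPGroup p P' := hstab ▸ hP.map _
      have hFe : fixedPoints M Q = fixedPoints M P' := by
        rw [← heq, fixedPoints_sup_of_le_ker (hR.trans inf_le_right)]
      have hZe : properTraces M Q = properTraces M P' := by
        ext v
        rw [F.mem_properTraces_iff hQ, F.mem_properTraces_iff hPp, hFe]
        refine and_congr_right fun _ => forall_congr' fun x => ?_
        -- `P' = QR`, and `R`, being normal and inside `P`, lies in every point stabilizer.
        have : (∀ q ∈ P', q • x = x) ↔ ∀ q ∈ Q, q • x = x := by
          change P' ≤ MulAction.stabilizer G x ↔ Q ≤ MulAction.stabilizer G x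
          rw [← heq, sup_le_iff, and_iff_left]
          obtain ⟨y, rfl⟩ := MulAction.exists_smul_eq G ((1 : G) : G ⧸ P) x
          rw [MulAction.stabilizer_smul_eq_stabilizer_map_conj, MulAction.stabilizer_quotient,
            ← hRconj y]
          exact Subgroup.map_mono (hR.trans inf_le_left)
        rw [this]
      rw [hFe, hZe]
      refine (F.sectionIndecomposable_stabilizer hV (haug _) hPp ?_).mono
        ((Subgroup.centralizer_le hQP').trans le_sup_right)
      rw [← hP', hstab, relIndex_map_conj]
      exact not_dvd_relIndex_of_isSaturated hsat
    -- The hypothesis concerns maximal subgroups of `P` itself, so `Q` is conjugated back into `P`.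
    · let Q₁ : Subgroup G := Q.map (MulAut.conj g⁻¹).toMonoidHom
      have hmap : (Q₁ ⊔ R).map (MulAut.conj g).toMonoidHom = Q ⊔ R := by
        rw [Subgroup.map_sup, hRconj, Subgroup.map_map]
        congr 1
        convert Subgroup.map_id Q
        ext x
        simp [mul_assoc]
      have hlt' : Q₁ ⊔ R < P := by
        rwa [← Subgroup.map_lt_map_iff_of_injective (f := (MulAut.conj g).toMonoidHom)
          (MulAut.conj g).injective, hmap, ← hstab]
      obtain ⟨T, hle, hTP⟩ := exists_le_covBy_of_lt hlt'
      have hTind := (isIndecomposable_resSubgroup_iff.1 (hT T hTP (le_sup_right.trans hle))).2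
      have hTtriv : ∀ t ∈ T, ∀ v, M t v = v := fun t ht v =>
        F.apply_eq_self_of_isIndecomposable (hP.to_le hTP.le) hTind
          (x₀ := ((1 : G) : G ⧸ P)) (fun t ht => by
            rw [← MulAction.mem_stabilizer_iff, MulAction.stabilizer_quotient]
            exact hTP.le ht) (haug _) ht v
      have hQT : Q ≤ T.map (MulAut.conj g).toMonoidHom :=
        (le_sup_left.trans hmap.ge).trans (Subgroup.map_mono hle)
      have hQtriv : ∀ q ∈ Q, ∀ v, M q v = v := by
        intro q hq v
        obtain ⟨t, ht, rfl⟩ := hQT hq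
        change M (g * t * g⁻¹) v = v
        rw [map_mul, map_mul, Module.End.mul_apply, Module.End.mul_apply, hTtriv t ht,
          apply_apply_inv]
      -- With `Q` acting trivially, the section is all of `M`, and `C_G(Q)` contains the conjugate
      -- of `C_G(T)`, over which `M` is indecomposable.
      have hFtop : fixedPoints M Q = ⊤ :=
        eq_top_iff.2 fun v _ => mem_fixedPoints.2 fun q hq => hQtriv q hq v
      rw [properTraces_eq_bot hQ hQtriv, hFtop]
      refine (hTind.map_conj g).mono (le_trans ?_ le_sup_right)
      rw [map_conj_centralizer]
      exact Subgroup.centralizer_le hQT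
  -- The core of `P` fixes every point of `G ⧸ P`, hence every vector of a summand of the
  -- permutation module.
  · rw [MonoidHom.mem_ker]
    refine LinearMap.ext fun v => F.apply_eq_of_forall_smul_eq (fun x => ?_) v
    induction x using QuotientGroup.induction_on with
    | H y =>
      rw [MulAction.Quotient.smul_mk, QuotientGroup.eq]
      have := P.normalCore_le (P.normalCore.inv_mem (P.normalCore_normal.conj_mem g hg y⁻¹))
      simpa [mul_assoc] using this
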